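/- Let $\mathcal Q$ be a small quantaloid (a small category whose hom-sets are complete lattices and whose composition preserves arbitrary suprema in each variable). A $\mathcal Q$-category $\mathbb A$ has a set of objects $a$, each with a type $ta\in\mathcal Q$, and hom-arrows $\mathbb A(a',a)\colon ta\to ta'$ with $\mathbb A(a'',a')\circ\mathbb A(a',a)\le\mathbb A(a'',a)$ and $1_{ta}\le\mathbb A(a,a)$; $\mathbb A_X$ is the set of objects of type $X$, ordered by $a\le a'\iff 1_X\le\mathbb A(a,a')$. Let $\mathsf{Cocont}(\mathcal Q)$ be the locally ordered category of cocomplete $\mathcal Q$-categories (all small weighted colimits exist) and cocontinuous functors, where $F\le G$ iff $Fa\le Ga$ for all objects $a$, and $F\cong G$ iff $F\le G$ and $G\le F$. Let $\mathsf{QUANT}(\mathcal Q^{\mathrm{op}},\mathsf{Sup})$ be the category of $\mathcal Q$-modules: functors from $\mathcal Q^{\mathrm{op}}$ to the quantaloid $\mathsf{Sup}$ of complete lattices and supremum-preserving maps that preserve suprema of arrows, with natural transformations as arrows. Under the biequivalence $\mathsf{Cocont}(\mathcal Q)\simeq\mathsf{QUANT}(\mathcal Q^{\mathrm{op}},\mathsf{Sup})$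 a cocomplete $\mathcal Q$-category $\mathbb A$ is sent to the module $\mathcal F_{\mathbb A}$ with $\mathcal F_{\mathbb A}X=\mathbb A_X$ (isomorphic objects being identified) and $\mathcal F_{\mathbb A}(f)=-\otimes f\colon\mathbb A_Y\to\mathbb A_X$ for $f\colon X\to Y$, where $y\otimes f$ is the colimit of $y$ weighted by $f$; a module $\mathcal F$ is sent to the cocomplete $\mathcal Q$-category $\mathbb C_{\mathcal F}$ whose objects of type $X$ are the elements of $\mathcal FX$ and whose hom-arrows are $\mathbb C_{\mathcal F}(y,x)=\bigvee\{f\colon tx\to ty\mid\mathcal F(f)(y)\le x\}$. Let a cocomplete $\mathcal Q$-category $\mathbb A$ and a $\mathcal Q$-module $\mathcal F$ correspond to each other, that is, $\mathcal F\cong\mathcal F_{\mathbb A}$ or $\mathbb A\simeq\mathbb C_{\mathcal F}$ in $\mathsf{Cocont}(\mathcal Q)$. Then the following are equivalent: 1. $\mathbb A$ is a projective object of $\mathsf{Cocont}(\mathcal Q)$: for every arrow $F\colon\mathbb A\to\mathbb B$ and every epimorphism $G\colon\mathbb C\to\mathbb B$ of $\mathsf{Cocont}(\mathcal Q)$ there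 is an arrow $H\colon\mathbb A\to\mathbb C$ with $G\circ H\cong F$, where $G$ is an epimorphism if $K\circ G\cong L\circ G$ implies $K\cong L$ for all parallel arrows $K,L$ out of $\mathbb B$; 2. $\mathcal F$ is a projective object of the category $\mathsf{QUANT}(\mathcal Q^{\mathrm{op}},\mathsf{Sup})$: every arrow out of $\mathcal F$ factors through every epimorphism onto its codomain. -/

import Mathlib

open CategoryTheory Opposite

namespace QEnriched

universe w v u

/-! ### Locally ordered categories -/

/-- A locally ordered category: every hom-set carries a preorder and composition is monotone.
Two parallel arrows `f`, `g` are isomorphic, `f ≅ g`, when `f ≤ g` and `g ≤ f`, i.e. when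
`AntisymmRel (· ≤ ·) f g`. -/
class LocallyOrdered (K : Type u) [Category.{v} K] where
  homPreorder (X Y : K) : Preorder (X ⟶ Y)
  comp_mono {X Y Z : K} {f f' : X ⟶ Y} {g g' : Y ⟶ Z} :
    f ≤ f' → g ≤ g' → f ≫ g ≤ f' ≫ g'

attribute [reducible, instance] LocallyOrdered.homPreorder

section LocallyOrdered

variable {K : Type u} [Category.{v} K] [LocallyOrdered K]

/-- Isomorphism of parallel arrows. -/
def LocallyIso {X Y : K} (f g : X ⟶ Y) : Prop := AntisymmRel (· ≤ ·) f g

/-- Epimorphisms of a locally ordered category (up to isomorphism of arrows). -/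
def IsSurjection {X Y : K} (f : X ⟶ Y) : Prop :=
  ∀ ⦃Z : K⦄ (g h : Y ⟶ Z), LocallyIso (f ≫ g) (f ≫ h) → LocallyIso g h

/-- Projective objects of a locally ordered category: every arrow out of `A` factors, up to
isomorphism of arrows, through every epimorphism. -/
def IsProjective (A : K) : Prop :=
  ∀ ⦃B C : K⦄ (f : A ⟶ B) (g : C ⟶ B), IsSurjection g →
    ∃ h : A ⟶ C, LocallyIso (h ≫ g) f

/-- Equivalence of two objects of a locally ordered category. -/
def Equivalent (A B : K) : Prop :=
  ∃ (f : A ⟶ B) (g : B ⟶ A), LocallyIso (f ≫ g) (𝟙 A) ∧ LocallyIso (g ≫ f) (𝟙 B)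

end LocallyOrdered

/-! ### Quantaloids -/

/-- A quantaloid: a category whose hom-sets are complete lattices, such that composition
preserves arbitrary suprema in each variable. -/
class Quantaloid (Q : Type u) [Category.{v} Q] where
  homLattice (X Y : Q) : CompleteLattice (X ⟶ Y)
  sSup_comp {X Y Z : Q} (S : Set (X ⟶ Y)) (g : Y ⟶ Z) :
    sSup S ≫ g = sSup ((fun f => f ≫ g) '' S)
  comp_sSup {X Y Z : Q} (f : X ⟶ Y) (S : Set (Y ⟶ Z)) :
    f ≫ sSup S = sSup ((fun g => f ≫ g) '' S)

attribute [reducible, instance] Quantaloid.homLattice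

section Quantaloid

variable {Q : Type u} [Category.{v} Q] [Quantaloid Q]

theorem comp_mono {X Y Z : Q} {f f' : X ⟶ Y} {g g' : Y ⟶ Z} (hf : f ≤ f') (hg : g ≤ g') :
    f ≫ g ≤ f' ≫ g' := by
  have h1 : f ≫ g ≤ f' ≫ g := by
    have := Quantaloid.sSup_comp {f, f'} g
    rw [sSup_pair, sup_eq_right.2 hf] at this
    rw [this]
    exact le_sSup ⟨f, by simp, rfl⟩
  have h2 : f' ≫ g ≤ f' ≫ g' := by
    have := Quantaloid.comp_sSup f' {g, g'}
    rw [sSup_pair, sup_eq_right.2 hg] at this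
    rw [this]
    exact le_sSup ⟨g, by simp, rfl⟩
  exact h1.trans h2

/-- The lifting `[f, h]` of `h` through `f`: the largest `g` with `f ∘ g ≤ h`. -/
def lift {X Y Z : Q} (f : X ⟶ Y) (h : Z ⟶ Y) : Z ⟶ X := sSup {g | g ≫ f ≤ h}

theorem le_lift {X Y Z : Q} {f : X ⟶ Y} {h : Z ⟶ Y} {g : Z ⟶ X} :
    g ≤ lift f h ↔ g ≫ f ≤ h := by
  refine ⟨fun hg => (comp_mono hg le_rfl).trans ?_, fun hg => le_sSup hg⟩
  rw [lift, Quantaloid.sSup_comp]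
  exact sSup_le (by rintro _ ⟨k, hk, rfl⟩; exact hk)

/-- The opposite of a quantaloid: same local order, reversed composition. -/
instance oppositeQuantaloid : Quantaloid Qᵒᵖ where
  homLattice X Y :=
    letI : PartialOrder (X ⟶ Y) :=
      PartialOrder.lift (fun f => f.unop) (fun _ _ h => Quiver.Hom.unop_inj h)
    letI : SupSet (X ⟶ Y) := ⟨fun S => (sSup (Quiver.Hom.unop '' S)).op⟩
    completeLatticeOfSup (X ⟶ Y) fun S =>
      ⟨fun f hf => le_sSup (α := Y.unop ⟶ X.unop) ⟨f, hf, rfl⟩,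
        fun g hg => sSup_le (α := Y.unop ⟶ X.unop) (by
          rintro _ ⟨f, hf, rfl⟩; exact hg hf)⟩
  sSup_comp S g := by
    refine Quiver.Hom.unop_inj ?_
    change g.unop ≫ sSup (Quiver.Hom.unop '' S) = sSup (Quiver.Hom.unop '' _)
    rw [Quantaloid.comp_sSup, Set.image_image, Set.image_image]
    rfl
  comp_sSup f S := by
    refine Quiver.Hom.unop_inj ?_
    change sSup (Quiver.Hom.unop '' S) ≫ f.unop = sSup (Quiver.Hom.unop '' _)
    rw [Quantaloid.sSup_comp, Set.image_image, Set.image_image]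
    rfl

theorem op_sSup {X Y : Q} (S : Set (X ⟶ Y)) :
    (sSup S).op = sSup (Quiver.Hom.op '' S) := by
  refine Quiver.Hom.unop_inj ?_
  change sSup S = sSup (Quiver.Hom.unop '' (Quiver.Hom.op '' S))
  rw [Set.image_image]
  simp

end Quantaloid

/-- The property of a functor between quantaloids of preserving local suprema. -/
def isQuantaloidHom (P : Type u) [Category.{v} P] [Quantaloid P]
    (R : Type*) [Category R] [Quantaloid R] : ObjectProperty (P ⥤ R) :=
  fun F => ∀ ⦃X Y : P⦄ (S : Set (X ⟶ Y)), F.map (sSup S) = sSup ((fun f => F.map f) '' S)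

/-- `QUANT(P, R)`: homomorphisms of quantaloids from `P` to `R`, and natural transformations. -/
abbrev QUANT (P : Type u) [Category.{v} P] [Quantaloid P]
    (R : Type*) [Category R] [Quantaloid R] :=
  (isQuantaloidHom P R).FullSubcategory

/-! ### The quantaloid of suplattices -/

/-- Suplattices. -/
structure SupLat where
  of ::
  carrier : Type u
  [str : CompleteLattice carrier]

namespace SupLat

attribute [instance] SupLat.str

instance : CoeSort SupLat.{u} (Type u) := ⟨SupLat.carrier⟩

/-- The arrows of `Sup` are the maps preserving arbitrary suprema. -/
instance : LargeCategory.{u} SupLat.{u} where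
  Hom L M := sSupHom L M
  id L := sSupHom.id L
  comp f g := g.comp f

instance : ConcreteCategory SupLat.{u} (fun L M => sSupHom L M) where
  hom f := f
  ofHom f := f

/-- Supmorphisms are ordered pointwise. -/
instance : Quantaloid SupLat.{u} where
  homLattice L M :=
    letI : SupSet (sSupHom L M) :=
      ⟨fun S =>
        { toFun := fun x => ⨆ f ∈ S, f x
          map_sSup' := fun T => by
            apply le_antisymm
            · refine iSup₂_le fun f hf => ?_
              rw [map_sSup]
              refine sSup_le ?_
              rintro _ ⟨x, hx, rfl⟩
              exact (le_iSup₂ (f := fun (f : sSupHom L M) (_ : f ∈ S) => f x) f hf).trans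
                (le_sSup ⟨x, hx, rfl⟩)
            · refine sSup_le ?_
              rintro _ ⟨x, hx, rfl⟩
              refine iSup₂_le fun f hf => ?_
              exact (OrderHomClass.mono f (le_sSup hx)).trans
                (le_iSup₂ (f := fun (f : sSupHom L M) (_ : f ∈ S) => f (sSup T)) f hf) }⟩
    completeLatticeOfSup (sSupHom L M) fun S =>
      ⟨fun f hf x => le_iSup₂ (f := fun (f : sSupHom L M) (_ : f ∈ S) => f x) f hf,
        fun _ hg x => iSup₂_le fun _ hf => hg hf x⟩
  sSup_comp S g := by
    refine sSupHom.ext fun x => ?_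
    change g (⨆ f ∈ S, f x) = ⨆ k ∈ _, (k : sSupHom _ _) x
    rw [map_iSup₂, iSup_image]
    rfl
  comp_sSup f S := by
    refine sSupHom.ext fun x => ?_
    change (⨆ g ∈ S, g (f x)) = ⨆ k ∈ _, (k : sSupHom _ _) x
    rw [iSup_image]
    rfl

theorem sSup_apply {L M : SupLat.{u}} (S : Set (L ⟶ M)) (x : L) :
    (sSup S : L ⟶ M) x = ⨆ f ∈ S, (f : L ⟶ M) x := rfl

end SupLat

/-! ### Categories enriched in a small quantaloid -/

section Enriched

variable (Q : Type u) [SmallCategory Q] [Quantaloid Q]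

/-- A (small) `Q`-category `A`. The set of objects with its type map `t : A₀ → Q₀` is given by
the family of its fibres, so `obj X` is the set of objects of type `X`.
The hom-arrow `A(a', a)` goes from `t a` to `t a'`. -/
structure QCat where
  obj : Q → Type u
  hom {X Y : Q} (a' : obj Y) (a : obj X) : X ⟶ Y
  id_le {X : Q} (a : obj X) : 𝟙 X ≤ hom a a
  comp_le {X Y Z : Q} (a'' : obj Z) (a' : obj Y) (a : obj X) :
    hom a' a ≫ hom a'' a' ≤ hom a'' a

variable {Q}

/-- The order on the objects of a given type of a `Q`-category. -/
instance QCat.objPreorder (A : QCat Q) (X : Q) : Preorder (A.obj X) where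
  le a a' := 𝟙 X ≤ A.hom a a'
  le_refl a := A.id_le a
  le_trans a b c hab hbc := by
    have := (comp_mono hbc hab).trans (A.comp_le a b c)
    simpa using this

theorem QCat.le_def (A : QCat Q) {X : Q} (a a' : A.obj X) : a ≤ a' ↔ 𝟙 X ≤ A.hom a a' := Iff.rfl

/-- A functor of `Q`-categories: a type-preserving map with `A(a', a) ≤ B(Fa', Fa)`. -/
@[ext]
structure QFunctor (A B : QCat Q) where
  map {X : Q} : A.obj X → B.obj X
  le_map {X Y : Q} (a' : A.obj Y) (a : A.obj X) : A.hom a' a ≤ B.hom (map a') (map a)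

/-- The local order: `F ≤ G` when `1 ≤ B(Fa, Ga)` for every object `a`. -/
instance QFunctor.preorder (A B : QCat Q) : Preorder (QFunctor A B) where
  le F G := ∀ ⦃X : Q⦄ (a : A.obj X), F.map a ≤ G.map a
  le_refl F _ a := le_refl (F.map a)
  le_trans _ _ _ h h' _ a := le_trans (h a) (h' a)

/-- The identity functor. -/
def QFunctor.id (A : QCat Q) : QFunctor A A where
  map a := a
  le_map _ _ := le_rfl

/-- Composition of functors, in diagrammatic order. -/
def QFunctor.comp {A B C : QCat Q} (F : QFunctor A B) (G : QFunctor B C) : QFunctor A C where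
  map a := G.map (F.map a)
  le_map a' a := (F.le_map a' a).trans (G.le_map _ _)

theorem QFunctor.map_mono {A B : QCat Q} (F : QFunctor A B) {X : Q} {a a' : A.obj X}
    (h : a ≤ a') : F.map a ≤ F.map a' := le_trans (α := X ⟶ X) h (F.le_map a a')

/-- A distributor `Φ` from `A` to `B`, with elements `Φ(b, a)` going from `t a` to `t b`. -/
structure Distributor (A B : QCat Q) where
  app {X Y : Q} (b : B.obj Y) (a : A.obj X) : X ⟶ Y
  comp_hom_le {X Y Z : Q} (b' : B.obj Z) (b : B.obj Y) (a : A.obj X) :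
    app b a ≫ B.hom b' b ≤ app b' a
  hom_comp_le {X Y Z : Q} (b : B.obj Z) (a : A.obj Y) (a' : A.obj X) :
    A.hom a a' ≫ app b a ≤ app b a'

/-- `K` is the `Φ`-weighted colimit of `F`: `B(K-, -) = [Φ, B(F-, -)]`, the lifting of
distributors being computed elementwise as an infimum of liftings in `Q`. -/
def IsColimit {C D B : QCat Q} (Φ : Distributor D C) (F : QFunctor C B) (K : QFunctor D B) :
    Prop :=
  ∀ ⦃X Y : Q⦄ (d : D.obj X) (b : B.obj Y),
    B.hom (K.map d) b = ⨅ (Z : Q) (c : C.obj Z), lift (Φ.app c d) (B.hom (F.map c) b)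

/-- A `Q`-category is cocomplete when it has all weighted colimits. -/
def IsCocomplete (B : QCat Q) : Prop :=
  ∀ ⦃C D : QCat Q⦄ (Φ : Distributor D C) (F : QFunctor C B), ∃ K, IsColimit Φ F K

/-- A functor is cocontinuous when it preserves all weighted colimits that exist. -/
def IsCocontinuous {A B : QCat Q} (G : QFunctor A B) : Prop :=
  ∀ ⦃C D : QCat Q⦄ (Φ : Distributor D C) (F : QFunctor C A) (K : QFunctor D A),
    IsColimit Φ F K → IsColimit Φ (F.comp G) (K.comp G)

variable (Q) in
/-- Cocomplete `Q`-categories, the objects of `Cocont(Q)`. -/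
structure Cocont extends QCat Q where
  cocomplete : IsCocomplete toQCat

/-- Cocontinuous functors, the arrows of `Cocont(Q)`. -/
@[ext]
structure CocontFunctor (A B : Cocont Q) extends QFunctor A.toQCat B.toQCat where
  cocontinuous : IsCocontinuous toQFunctor

/-- The category `Cocont(Q)`. -/
instance : Category (Cocont Q) where
  Hom A B := CocontFunctor A B
  id A := ⟨QFunctor.id A.toQCat, fun _ _ _ _ _ h => h⟩
  comp F G := ⟨F.toQFunctor.comp G.toQFunctor,
    fun _ _ _ _ _ h => G.cocontinuous _ _ _ (F.cocontinuous _ _ _ h)⟩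

/-- The local order of `Cocont(Q)`. -/
instance : LocallyOrdered (Cocont Q) where
  homPreorder A B := Preorder.lift
    (fun F : CocontFunctor A B => F.toQFunctor)
  comp_mono {_ _ _ _ f' g _} hf hg _ a :=
    le_trans (QFunctor.map_mono g.toQFunctor (hf a)) (hg (f'.map a))

/-! ### Tensors and suprema in a cocomplete `Q`-category -/

/-- The objects of the one-object `Q`-category `*_X`. -/
inductive PtObj (X : Q) : Q → Type u
  | star : PtObj X X

/-- The hom-arrows of `*_X`: its only hom-arrow is the identity of `X`. -/
def PtObj.hom {X : Q} : {Y Z : Q} → PtObj X Z → PtObj X Y → (Y ⟶ Z)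
  | _, _, .star, .star => 𝟙 X

/-- The one-object `Q`-category `*_X`. -/
def pt (X : Q) : QCat Q where
  obj := PtObj X
  hom := PtObj.hom
  id_le := by rintro _ ⟨⟩; exact le_rfl
  comp_le := by rintro _ _ _ ⟨⟩ ⟨⟩ ⟨⟩; exact (Category.id_comp _).le

/-- The functor from `*_X` picking an object of type `X`. -/
def ptFunctor (A : QCat Q) {X : Q} (a : A.obj X) : QFunctor (pt X) A where
  map := fun | .star => a
  le_map := by rintro _ _ ⟨⟩ ⟨⟩; exact A.id_le a

/-- The elements of the distributor given by an arrow of `Q`. -/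
def ptDist.app {X Y : Q} (f : X ⟶ Y) : {V W : Q} → PtObj Y W → PtObj X V → (V ⟶ W)
  | _, _, .star, .star => f

/-- The distributor from `*_X` to `*_Y` given by an arrow `f : X ⟶ Y`. -/
def ptDist {X Y : Q} (f : X ⟶ Y) : Distributor (pt X) (pt Y) where
  app := ptDist.app f
  comp_hom_le := by rintro _ _ _ ⟨⟩ ⟨⟩ ⟨⟩; exact (Category.comp_id _).le
  hom_comp_le := by rintro _ _ _ ⟨⟩ ⟨⟩ ⟨⟩; exact (Category.id_comp _).le

/-- `z` is the tensor `y ⊗ f`, i.e. the colimit of `y` weighted by `f`. -/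
def IsTensor (A : QCat Q) {X Y : Q} (y : A.obj Y) (f : X ⟶ Y) (z : A.obj X) : Prop :=
  IsColimit (ptDist f) (ptFunctor A y) (ptFunctor A z)

theorem isTensor_iff {A : QCat Q} {X Y : Q} {y : A.obj Y} {f : X ⟶ Y} {z : A.obj X} :
    IsTensor A y f z ↔ ∀ ⦃Z : Q⦄ (b : A.obj Z), A.hom z b = lift f (A.hom y b) := by
  have key : ∀ ⦃Z : Q⦄ (b : A.obj Z),
      (⨅ (W : Q) (c : (pt Y).obj W), lift ((ptDist f).app c (.star : PtObj X X))
        (A.hom ((ptFunctor A y).map c) b)) = lift f (A.hom y b) := by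
    intro Z b
    apply le_antisymm
    · exact iInf₂_le (f := fun (W : Q) (c : (pt Y).obj W) =>
        lift ((ptDist f).app c (.star : PtObj X X)) (A.hom ((ptFunctor A y).map c) b)) Y .star
    · refine le_iInf₂ ?_
      rintro _ ⟨⟩
      exact le_rfl
  constructor
  · intro h Z b
    exact (h (.star : PtObj X X) b).trans (key b)
  · rintro h _ Z ⟨⟩ b
    exact (h b).trans (key b).symm

theorem ptFunctor_eta {A : QCat Q} {X : Q} (K : QFunctor (pt X) A) :
    K = ptFunctor A (K.map (.star : PtObj X X)) := by
  ext _ ⟨⟩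
  rfl

theorem ptFunctor_comp {A B : QCat Q} {X : Q} (a : A.obj X) (F : QFunctor A B) :
    (ptFunctor A a).comp F = ptFunctor B (F.map a) := ptFunctor_eta _

theorem exists_isTensor {A : QCat Q} (hA : IsCocomplete A) {X Y : Q} (y : A.obj Y) (f : X ⟶ Y) :
    ∃ z, IsTensor A y f z := by
  obtain ⟨K, hK⟩ := hA (ptDist f) (ptFunctor A y)
  exact ⟨K.map (.star : PtObj X X), by rw [IsTensor, ← ptFunctor_eta]; exact hK⟩

/-- The elements of the presheaf generated by a set of objects of type `X`. -/
def supWeight.app (A : QCat Q) {X : Q} (S : Set (A.obj X)) :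
    {V W : Q} → A.obj W → PtObj X V → (V ⟶ W)
  | _, _, a, .star => ⨆ s ∈ S, A.hom a s

/-- The presheaf generated by a set of objects of type `X`. -/
def supWeight (A : QCat Q) {X : Q} (S : Set (A.obj X)) : Distributor (pt X) A where
  app := supWeight.app A S
  comp_hom_le := by
    rintro _ _ _ b' b ⟨⟩
    rw [← le_lift]
    refine iSup₂_le fun s hs => ?_
    rw [le_lift]
    exact (A.comp_le b' b s).trans (le_iSup₂ (f := fun (s : A.obj X) (_ : s ∈ S) => A.hom b' s) s hs)
  hom_comp_le := by rintro _ _ _ b ⟨⟩ ⟨⟩; exact (Category.id_comp _).le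

theorem supWeight_iff {A B : QCat Q} {X : Q} {S : Set (A.obj X)} {F : QFunctor A B}
    {k : B.obj X} : IsColimit (supWeight A S) F (ptFunctor B k) ↔
      ∀ ⦃Z : Q⦄ (b : B.obj Z), B.hom k b = ⨅ s ∈ S, B.hom (F.map s) b := by
  have key : ∀ ⦃Z : Q⦄ (b : B.obj Z),
      (⨅ (W : Q) (c : A.obj W), lift ((supWeight A S).app c (.star : PtObj X X))
        (B.hom (F.map c) b)) = ⨅ s ∈ S, B.hom (F.map s) b := by
    intro Z b
    apply le_antisymm
    · refine le_iInf₂ fun s hs => ?_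
      refine (iInf₂_le (f := fun (W : Q) (c : A.obj W) =>
        lift ((supWeight A S).app c (.star : PtObj X X)) (B.hom (F.map c) b)) X s).trans ?_
      have h := (le_lift (g := lift ((supWeight A S).app s (.star : PtObj X X))
        (B.hom (F.map s) b))).1 le_rfl
      have h1 : 𝟙 X ≤ (supWeight A S).app s (.star : PtObj X X) :=
        (A.id_le s).trans (le_iSup₂ (f := fun (a : A.obj X) (_ : a ∈ S) => A.hom s a) s hs)
      have := (comp_mono le_rfl h1).trans h
      simpa using this
    · refine le_iInf₂ fun W c => ?_
      rw [le_lift]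
      have h2 : (supWeight A S).app c (.star : PtObj X X) = sSup ((fun s => A.hom c s) '' S) := by
        rw [sSup_image]; rfl
      rw [h2, Quantaloid.comp_sSup]
      refine sSup_le ?_
      rintro _ ⟨_, ⟨s, hs, rfl⟩, rfl⟩
      refine (comp_mono (iInf₂_le s hs) (F.le_map c s)).trans ?_
      exact B.comp_le _ _ _
  constructor
  · intro h Z b
    exact (h (.star : PtObj X X) b).trans (key b)
  · rintro h _ Z ⟨⟩ b
    exact (h b).trans (key b).symm

theorem exists_sup {A : QCat Q} (hA : IsCocomplete A) {X : Q} (S : Set (A.obj X)) :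
    ∃ k : A.obj X, ∀ ⦃Z : Q⦄ (b : A.obj Z), A.hom k b = ⨅ s ∈ S, A.hom s b := by
  obtain ⟨K, hK⟩ := hA (supWeight A S) (QFunctor.id A)
  refine ⟨K.map (.star : PtObj X X), supWeight_iff (F := QFunctor.id A).1 ?_⟩
  rw [← ptFunctor_eta]
  exact hK

namespace Cocont

variable (A : Cocont Q)

/-- The tensor `y ⊗ f` in a cocomplete `Q`-category (determined up to isomorphism). -/
noncomputable def tensor {X Y : Q} (y : A.obj Y) (f : X ⟶ Y) : A.obj X :=
  (exists_isTensor A.cocomplete y f).choose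

theorem isTensor_tensor {X Y : Q} (y : A.obj Y) (f : X ⟶ Y) :
    IsTensor A.toQCat y f (A.tensor y f) :=
  (exists_isTensor A.cocomplete y f).choose_spec

theorem hom_tensor {X Y Z : Q} (y : A.obj Y) (f : X ⟶ Y) (b : A.obj Z) :
    A.hom (A.tensor y f) b = lift f (A.hom y b) := isTensor_iff.1 (A.isTensor_tensor y f) b

theorem tensor_le {X Y : Q} {y : A.obj Y} {f : X ⟶ Y} {z : A.obj X} :
    A.tensor y f ≤ z ↔ f ≤ A.hom y z := by
  rw [QCat.le_def, hom_tensor, le_lift, Category.id_comp]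

/-- The suplattice `A_X`: objects of type `X` of `A`, up to isomorphism. -/
abbrev Fibre (X : Q) : Type u := Antisymmetrization (A.obj X) (· ≤ ·)

variable {A} in
/-- The isomorphism class of an object. -/
abbrev cls {X : Q} (a : A.obj X) : A.Fibre X := toAntisymmetrization (· ≤ ·) a

variable {A} in
theorem cls_le_cls {X : Q} {a b : A.obj X} : cls a ≤ cls b ↔ a ≤ b := Iff.rfl

/-- The supremum in `A` of a set of objects of type `X` (determined up to isomorphism). -/
noncomputable def sup {X : Q} (S : Set (A.obj X)) : A.obj X :=
  (exists_sup A.cocomplete S).choose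

theorem hom_sup {X Z : Q} (S : Set (A.obj X)) (b : A.obj Z) :
    A.hom (A.sup S) b = ⨅ s ∈ S, A.hom s b := (exists_sup A.cocomplete S).choose_spec b

theorem isLUB_cls_sup {X : Q} (S : Set (A.Fibre X)) :
    IsLUB S (cls (A.sup {a : A.obj X | cls a ∈ S})) := by
  have h : ∀ b : A.obj X, cls (A.sup {a : A.obj X | cls a ∈ S}) ≤ cls b ↔
      ∀ a : A.obj X, cls a ∈ S → cls a ≤ cls b := by
    intro b
    rw [cls_le_cls, QCat.le_def, hom_sup, le_iInf₂_iff]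
    rfl
  refine ⟨fun q hq => ?_, fun q hq => ?_⟩
  · induction q using Antisymmetrization.ind with
    | _ a => exact (h _).1 le_rfl a hq
  · induction q using Antisymmetrization.ind with
    | _ b => exact (h b).2 fun a ha => hq ha

noncomputable instance (X : Q) : CompleteLattice (A.Fibre X) :=
  letI : SupSet (A.Fibre X) := ⟨fun S => cls (A.sup {a : A.obj X | cls a ∈ S})⟩
  completeLatticeOfSup (A.Fibre X) A.isLUB_cls_sup

theorem sSup_fibre {X : Q} (S : Set (A.Fibre X)) :
    sSup S = cls (A.sup {a : A.obj X | cls a ∈ S}) := rfl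

/-- The map `- ⊗ f` on isomorphism classes of objects. -/
noncomputable def act {X Y : Q} (f : X ⟶ Y) : A.Fibre Y → A.Fibre X :=
  (OrderHom.mk (fun y : A.obj Y => A.tensor y f) (fun y y' h => by
    rw [tensor_le]
    have h1 := (A.tensor_le (y := y') (f := f)).1 le_rfl
    have := (comp_mono h1 h).trans (A.comp_le _ _ _)
    simpa using this)).antisymmetrization

theorem act_cls {X Y : Q} (f : X ⟶ Y) (y : A.obj Y) : A.act f (cls y) = cls (A.tensor y f) := rfl

theorem act_cls_le {X Y : Q} {f : X ⟶ Y} {y : A.obj Y} {z : A.obj X} :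
    A.act f (cls y) ≤ cls z ↔ f ≤ A.hom y z := A.tensor_le

theorem fibre_ext {X : Q} {p q : A.Fibre X} (h : ∀ z : A.obj X, p ≤ cls z ↔ q ≤ cls z) : p = q :=
  eq_of_forall_ge_iff fun r => by
    induction r using Antisymmetrization.ind with
    | _ z => exact h z

/-- The supmorphism `- ⊗ f : A_Y → A_X` for `f : X ⟶ Y`. -/
noncomputable def actHom {X Y : Q} (f : X ⟶ Y) : sSupHom (A.Fibre Y) (A.Fibre X) where
  toFun := A.act f
  map_sSup' S := by
    refine A.fibre_ext fun z => ?_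
    rw [sSup_fibre, act_cls_le, hom_sup, le_iInf₂_iff, sSup_le_iff]
    constructor
    · rintro h _ ⟨q, hq, rfl⟩
      induction q using Antisymmetrization.ind with
      | _ a => exact A.act_cls_le.2 (h a hq)
    · intro h a ha
      exact A.act_cls_le.1 (h _ ⟨_, ha, rfl⟩)

/-- The module of a cocomplete `Q`-category as a functor: `X ↦ A_X`, and
`f : X ⟶ Y` acts as `- ⊗ f : A_Y → A_X`. -/
noncomputable def moduleFunctor : Qᵒᵖ ⥤ SupLat.{u} where
  obj X := SupLat.of (A.Fibre X.unop)
  map f := A.actHom f.unop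
  map_id X := by
    refine sSupHom.ext fun q => ?_
    induction q using Antisymmetrization.ind with
    | _ a => exact A.fibre_ext fun z => A.act_cls_le
  map_comp {X Y Z} f g := by
    refine sSupHom.ext fun q => ?_
    induction q using Antisymmetrization.ind with
    | _ a =>
      refine A.fibre_ext fun z => ?_
      change A.act (g.unop ≫ f.unop) (cls a) ≤ cls z ↔ A.act g.unop (A.act f.unop (cls a)) ≤ cls z
      rw [act_cls, act_cls, act_cls, cls_le_cls, cls_le_cls, tensor_le, tensor_le, hom_tensor, le_lift]

theorem isQuantaloidHom_moduleFunctor : isQuantaloidHom Qᵒᵖ SupLat.{u} A.moduleFunctor := by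
  intro X Y S
  refine sSupHom.ext fun q => ?_
  induction q using Antisymmetrization.ind with
  | _ a =>
    refine A.fibre_ext fun z => ?_
    have h : (sSup ((fun f => A.moduleFunctor.map f) '' S) :
        SupLat.of (A.Fibre X.unop) ⟶ SupLat.of (A.Fibre Y.unop)) (cls a) = ⨆ f ∈ S, A.act f.unop (cls a) :=
      iSup_image
    change A.act (sSup (Quiver.Hom.unop '' S)) (cls a) ≤ cls z ↔
      (sSup ((fun f => A.moduleFunctor.map f) '' S) :
        SupLat.of (A.Fibre X.unop) ⟶ SupLat.of (A.Fibre Y.unop)) (cls a) ≤ cls z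
    rw [h, act_cls_le, sSup_le_iff, iSup₂_le_iff, Set.forall_mem_image]
    exact forall₂_congr fun f _ => A.act_cls_le.symm

end Cocont

/-- The action on an isomorphism class of a functor of `Q`-categories. -/
def fibreMap {A B : Cocont Q} (F : A ⟶ B) (X : Q) : A.Fibre X → B.Fibre X :=
  (OrderHom.mk (fun a : A.obj X => F.map a)
    (fun _ _ h => QFunctor.map_mono F.toQFunctor h)).antisymmetrization

/-- A cocontinuous functor preserves suprema in each fibre. -/
def fibreHom {A B : Cocont Q} (F : A ⟶ B) (X : Q) : sSupHom (A.Fibre X) (B.Fibre X) where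
  toFun := fibreMap F X
  map_sSup' S := by
    have hcol : IsColimit (supWeight A.toQCat {a : A.obj X | Cocont.cls a ∈ S})
        (QFunctor.id A.toQCat) (ptFunctor A.toQCat (A.sup {a : A.obj X | Cocont.cls a ∈ S})) :=
      supWeight_iff.2 fun _ b => A.hom_sup _ b
    have h := F.cocontinuous _ _ _ hcol
    rw [ptFunctor_comp, supWeight_iff] at h
    refine B.fibre_ext fun z => ?_
    change F.map (A.sup {a : A.obj X | Cocont.cls a ∈ S}) ≤ z ↔ _
    rw [QCat.le_def, h, le_iInf₂_iff, sSup_le_iff]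
    constructor
    · rintro h _ ⟨q, hq, rfl⟩
      induction q using Antisymmetrization.ind with
      | _ a => exact h a hq
    · intro h a ha
      exact h _ ⟨_, ha, rfl⟩

theorem fibreMap_act {A B : Cocont Q} (F : A ⟶ B) {X Y : Q} (f : X ⟶ Y) (q : A.Fibre Y) :
    fibreMap F X (A.act f q) = B.act f (fibreMap F Y q) := by
  induction q using Antisymmetrization.ind with
  | _ a =>
    refine B.fibre_ext fun z => ?_
    have h := F.cocontinuous _ _ _ (A.isTensor_tensor a f)
    rw [ptFunctor_comp, ptFunctor_comp] at h
    change F.map (A.tensor a f) ≤ z ↔ B.tensor (F.map a) f ≤ z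
    rw [QCat.le_def, isTensor_iff.1 h, le_lift, Category.id_comp, Cocont.tensor_le]

/-- The functor `Cocont(Q) ⥤ QUANT(Qᵒᵖ, Sup)` underlying the biequivalence: a cocomplete
`Q`-category `A` is sent to the module `X ↦ A_X`, `f ↦ - ⊗ f`, and a cocontinuous functor to its
restrictions to the fibres. -/
noncomputable def toModule : Cocont Q ⥤ QUANT Qᵒᵖ SupLat.{u} where
  obj A := ⟨A.moduleFunctor, A.isQuantaloidHom_moduleFunctor⟩
  map {A B} F := ObjectProperty.homMk
    { app := fun X => fibreHom F X.unop
      naturality := fun _ _ f => sSupHom.ext fun q => fibreMap_act F f.unop q }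
  map_id A := by
    refine ObjectProperty.hom_ext _ (NatTrans.ext (funext fun X => sSupHom.ext fun q => ?_))
    induction q using Antisymmetrization.ind with
    | _ a => rfl
  map_comp F G := by
    refine ObjectProperty.hom_ext _ (NatTrans.ext (funext fun X => sSupHom.ext fun q => ?_))
    induction q using Antisymmetrization.ind with
    | _ a => rfl

/-! ### The cocomplete `Q`-category of a module -/

section OfModule

variable (F : QUANT Qᵒᵖ SupLat.{u})

/-- The value `F(X)` of a `Q`-module. -/
abbrev fib (X : Q) : SupLat.{u} := F.obj.obj (op X)

/-- The map `F(f) : F(Y) → F(X)` for `f : X ⟶ Y`. -/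
abbrev res {X Y : Q} (f : X ⟶ Y) : sSupHom (fib F Y) (fib F X) := F.obj.map f.op

theorem res_id {X : Q} (x : fib F X) : res F (𝟙 X) x = x :=
  DFunLike.congr_fun (F := sSupHom (fib F X) (fib F X)) (F.obj.map_id (op X)) x

theorem res_comp {X Y Z : Q} (f : X ⟶ Y) (g : Y ⟶ Z) (z : fib F Z) :
    res F (f ≫ g) z = res F f (res F g z) :=
  DFunLike.congr_fun (F := sSupHom (fib F Z) (fib F X)) (F.obj.map_comp g.op f.op) z

theorem res_sSup {X Y : Q} (S : Set (X ⟶ Y)) (y : fib F Y) :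
    res F (sSup S) y = ⨆ f ∈ S, res F f y := by
  have h := F.property (Quiver.Hom.op '' S)
  rw [← op_sSup] at h
  refine (DFunLike.congr_fun (F := sSupHom (fib F Y) (fib F X)) h y).trans ?_
  change (⨆ k ∈ _, (k : sSupHom _ _) y) = _
  rw [iSup_image, iSup_image]

/-- The hom-arrow `C_F(y, x) = ⋁ {f : t x → t y | F(f)(y) ≤ x}`. -/
def modHom {X Y : Q} (y : fib F Y) (x : fib F X) : X ⟶ Y := sSup {f | res F f y ≤ x}

theorem le_modHom {X Y : Q} {y : fib F Y} {x : fib F X} {f : X ⟶ Y} :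
    f ≤ modHom F y x ↔ res F f y ≤ x := by
  refine ⟨fun h => ?_, fun h => le_sSup h⟩
  have h1 : res F f y ≤ res F (modHom F y x) y := by
    have := res_sSup F {f, modHom F y x} y
    rw [sSup_pair, sup_eq_right.2 h] at this
    rw [this]
    exact le_iSup₂ (f := fun (k : X ⟶ Y) (_ : k ∈ ({f, modHom F y x} : Set _)) => res F k y) f
      (by simp)
  refine h1.trans ?_
  rw [modHom, res_sSup]
  exact iSup₂_le fun k hk => hk

/-- The `Q`-category `C_F` of a module: objects of type `X` are the elements of `F(X)`. -/
def modCat : QCat Q where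
  obj X := fib F X
  hom y x := modHom F y x
  id_le x := (le_modHom F).2 (res_id F x).le
  comp_le z y x := (le_modHom F).2 (by
    rw [res_comp]
    exact (OrderHomClass.mono _ ((le_modHom F).1 le_rfl)).trans ((le_modHom F).1 le_rfl))

theorem modCat_cocomplete : IsCocomplete (modCat F) := by
  intro C D Φ G
  have key : ∀ (x : ∀ Z, C.obj Z → fib F Z) ⦃X Y : Q⦄ (d : D.obj X) (b : fib F Y) (g : Y ⟶ X),
      res F g (⨆ (Z : Q) (c : C.obj Z), res F (Φ.app c d) (x Z c)) ≤ b ↔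
        ∀ (Z : Q) (c : C.obj Z), res F (g ≫ Φ.app c d) (x Z c) ≤ b := by
    intro x X Y d b g
    rw [map_iSup₂, iSup₂_le_iff]
    exact forall₂_congr fun Z c => by rw [res_comp]
  refine ⟨{ map := fun {X} d => (⨆ (Z : Q) (c : C.obj Z),
                res F (Φ.app c d) (G.map c : fib F Z) : fib F X)
            le_map := fun {X Y} d' d => ?_ }, ?_⟩
  · refine (le_modHom F).2 ((key (fun _ c => G.map c) _ _ _).2 fun Z c => ?_)
    refine le_trans ?_ (le_iSup₂ (f := fun (Z : Q) (c : C.obj Z) =>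
      res F (Φ.app c d) (G.map c : fib F Z)) Z c)
    exact (le_modHom F).1 ((Φ.hom_comp_le c d' d).trans ((le_modHom F).2 le_rfl))
  · intro X Y d b
    refine eq_of_forall_le_iff fun g => ?_
    rw [le_iInf₂_iff]
    refine (le_modHom F).trans ((key (fun _ c => G.map c) d b g).trans (forall₂_congr fun Z c => ?_))
    rw [le_lift]
    exact (le_modHom F).symm

/-- The cocomplete `Q`-category of a module. -/
def ofModule : Cocont Q := ⟨modCat F, modCat_cocomplete F⟩

end OfModule

end Enriched

end QEnriched

open QEnriched

namespace QEnriched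

universe u

variable {Q : Type u} [SmallCategory Q] [Quantaloid Q]

/-! ### The functor `toModule` is locally faithful -/

/-! Epimorphy and projectivity in `Cocont Q` are stated up to isomorphism of arrows, so they depend
only on the category obtained by identifying isomorphic parallel arrows. `toModule` induces an
equivalence from that quotient category to the category of modules, and an equivalence preserves and
reflects epimorphisms and projective objects.

Three facts make up the equivalence. Isomorphic arrows are exactly those with the same image
(`locallyIso_iff_toModule_map_eq`). Every module morphism is the image of a cocontinuous functor
(`toModule_map_cocontOfModuleHom`). Every module `F` is isomorphic to the module of `C_F`
(`toModuleOfModuleIso`).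

The substance lies in fullness. A module morphism preserves suprema, so it has a right adjoint on
each fibre. Its compatibility with tensors upgrades these fibrewise adjunctions to an equality of
hom-arrows `B(Ga, b) = A(a, Rb)`, which yields both functoriality and cocontinuity of `G`. -/

theorem Cocont.cls_eq_cls {A : Cocont Q} {X : Q} {a b : A.obj X} :
    Cocont.cls a = Cocont.cls b ↔ a ≤ b ∧ b ≤ a := by
  rw [le_antisymm_iff, cls_le_cls, cls_le_cls]

theorem toModule_map_app_cls {A B : Cocont Q} (G : A ⟶ B) {X : Q} (a : A.obj X) :
    ((toModule.map G).hom.app (op X) : sSupHom (A.Fibre X) (B.Fibre X)) (Cocont.cls a) =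
      Cocont.cls (G.map a) := rfl

/-- The fibres of the module are quotients by isomorphism of objects, and the local order is
objectwise, so agreeing on all classes is the same as being isomorphic. -/
theorem locallyIso_iff_toModule_map_eq {A B : Cocont Q} (G H : A ⟶ B) :
    LocallyIso G H ↔ toModule.map G = toModule.map H := by
  constructor
  · intro h
    refine ObjectProperty.hom_ext _ (NatTrans.ext (funext fun X => sSupHom.ext fun q => ?_))
    induction q using Antisymmetrization.ind with
    | _ a => exact Cocont.cls_eq_cls.2 ⟨h.1 a, h.2 a⟩
  · intro h
    have key {X : Q} (a : A.obj X) : Cocont.cls (G.map a) = Cocont.cls (H.map a) := by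
      rw [← toModule_map_app_cls, ← toModule_map_app_cls, h]
    exact ⟨fun _ a => (Cocont.cls_eq_cls.1 (key a)).1, fun _ a => (Cocont.cls_eq_cls.1 (key a)).2⟩

/-! ### The functor `toModule` is full -/

/-- A functor with a right adjoint is cocontinuous. -/
theorem isCocontinuous_of_adjoint {A B : QCat Q} (G : QFunctor A B)
    (R : ∀ {Y : Q}, B.obj Y → A.obj Y)
    (h : ∀ {X Y : Q} (a : A.obj X) (b : B.obj Y), B.hom (G.map a) b = A.hom a (R b)) :
    IsCocontinuous G := by
  -- Evaluate the universal property of the colimit `K` at `R b`, and pass across the adjunction on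
  -- both sides.
  intro C D Φ F K hK X Y d b
  refine (h (K.map d) b).trans ((hK d (R b)).trans ?_)
  exact iInf_congr fun Z => iInf_congr fun c => congrArg _ (h (F.map c) b).symm

section Full

variable {A B : Cocont Q} (α : toModule.obj A ⟶ toModule.obj B)

/-- The component of a morphism of modules at an object of `Q`. -/
def moduleApp (X : Q) : sSupHom (A.Fibre X) (B.Fibre X) := α.hom.app (op X)

theorem moduleApp_act {X Y : Q} (f : X ⟶ Y) (q : A.Fibre Y) :
    moduleApp α X (A.act f q) = B.act f (moduleApp α Y q) :=
  DFunLike.congr_fun (F := sSupHom (A.Fibre Y) (B.Fibre X)) (α.hom.naturality f.op) q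

/-- An object representing the image of an object under a morphism of modules. -/
noncomputable def moduleLift {X : Q} (a : A.obj X) : B.obj X :=
  ofAntisymmetrization (· ≤ ·) (moduleApp α X (Cocont.cls a))

theorem cls_moduleLift {X : Q} (a : A.obj X) :
    Cocont.cls (moduleLift α a) = moduleApp α X (Cocont.cls a) :=
  toAntisymmetrization_ofAntisymmetrization _ _

/-- The right adjoint of a morphism of modules, on objects. -/
noncomputable def moduleRightAdjoint {Y : Q} (b : B.obj Y) : A.obj Y :=
  ofAntisymmetrization (· ≤ ·) (sSup {q | moduleApp α Y q ≤ Cocont.cls b})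

/-- The Galois connection attached to a supremum-preserving map: the largest `q` sent below a given
class exists because its defining set is closed under suprema. -/
theorem le_moduleRightAdjoint {Y : Q} (q : A.Fibre Y) (b : B.obj Y) :
    q ≤ Cocont.cls (moduleRightAdjoint α b) ↔ moduleApp α Y q ≤ Cocont.cls b := by
  have e : Cocont.cls (moduleRightAdjoint α b) = sSup {q | moduleApp α Y q ≤ Cocont.cls b} :=
    toAntisymmetrization_ofAntisymmetrization _ _
  rw [e]
  refine ⟨fun h => (OrderHomClass.mono (moduleApp α Y) h).trans ?_, fun h => le_sSup h⟩
  rw [map_sSup]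
  exact sSup_le (by rintro _ ⟨p, hp, rfl⟩; exact hp)

/-- Tensors reduce hom-arrows to the order of the fibres. With `G` the lift and `R` the right
adjoint, `f ≤ B(Ga, b)` iff `Ga ⊗ f ≤ b` iff `α(a ⊗ f) ≤ b` iff `a ⊗ f ≤ Rb` iff `f ≤ A(a, Rb)`. -/
theorem hom_moduleLift {X Y : Q} (a : A.obj X) (b : B.obj Y) :
    B.hom (moduleLift α a) b = A.hom a (moduleRightAdjoint α b) := by
  refine eq_of_forall_le_iff fun f => ?_
  rw [← Cocont.act_cls_le, ← Cocont.act_cls_le, le_moduleRightAdjoint, moduleApp_act,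
    cls_moduleLift]

/-- The cocontinuous functor inducing a given morphism of modules. -/
noncomputable def cocontOfModuleHom : A ⟶ B :=
  letI G : QFunctor A.toQCat B.toQCat :=
    { map := moduleLift α
      le_map := fun a' a => by
        -- The unit of the adjunction; composing with it gives `A(a', a) ≤ A(a', RGa) = B(Ga', Ga)`.
        have h : a ≤ moduleRightAdjoint α (moduleLift α a) := by
          rw [← Cocont.cls_le_cls, le_moduleRightAdjoint, cls_moduleLift]
        rw [hom_moduleLift]
        simpa using (comp_mono h (le_refl (A.hom a' a))).trans (A.comp_le _ _ _) }
  (⟨G, isCocontinuous_of_adjoint G (moduleRightAdjoint α) (hom_moduleLift α)⟩ :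
    CocontFunctor A B)

theorem toModule_map_cocontOfModuleHom : toModule.map (cocontOfModuleHom α) = α := by
  refine ObjectProperty.hom_ext _ (NatTrans.ext (funext fun X => sSupHom.ext fun q => ?_))
  induction q using Antisymmetrization.ind with
  | _ a => exact cls_moduleLift α a

end Full

instance : (toModule (Q := Q)).Full where
  map_surjective α := ⟨cocontOfModuleHom α, toModule_map_cocontOfModuleHom α⟩

/-! ### The functor `toModule` is essentially surjective -/

section EssSurj

variable (F : QUANT Qᵒᵖ SupLat.{u})

/-- The left-hand order is the one derived from the hom-arrows of `C_F`, the right-hand one is that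
of the suplattice. They agree because `1 ≤ C_F(x, y)` means `F(1)(x) ≤ y`. -/
theorem ofModule_le_iff {X : Q} {x y : fib F X} :
    @LE.le ((ofModule F).obj X) _ x y ↔ x ≤ y :=
  (le_modHom F).trans (by rw [res_id])

/-- The fibres of `C_F` are the values of `F`. -/
noncomputable def ofModuleFibreIso (X : Q) : (ofModule F).Fibre X ≃o fib F X where
  toFun q := ofAntisymmetrization (α := (ofModule F).obj X) (· ≤ ·) q
  invFun x := Cocont.cls (A := ofModule F) x
  left_inv q := toAntisymmetrization_ofAntisymmetrization _ q
  right_inv x := by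
    -- The chosen representative is only isomorphic to `x` in `C_F`, but the order there is already
    -- antisymmetric, so it equals `x`.
    have h := Cocont.cls_eq_cls.1 (toAntisymmetrization_ofAntisymmetrization
      (· ≤ ·) (Cocont.cls (A := ofModule F) x))
    exact le_antisymm ((ofModule_le_iff F).1 h.1) ((ofModule_le_iff F).1 h.2)
  map_rel_iff' {p q} :=
    (ofModule_le_iff F).symm.trans ofAntisymmetrization_le_ofAntisymmetrization_iff

/-- The element `F(f)(y)` is the tensor `y ⊗ f` in `C_F`: both lie below `z` iff `f ≤ C_F(y, z)`.
This is the naturality needed to make the fibrewise isomorphisms a module isomorphism. -/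
theorem ofModuleFibreIso_symm_res {X Y : Q} (f : X ⟶ Y) (y : fib F Y) :
    (ofModuleFibreIso F X).symm (res F f y) =
      (ofModule F).act f ((ofModuleFibreIso F Y).symm y) := by
  refine (ofModule F).fibre_ext fun z => ?_
  refine Iff.trans ?_ (Cocont.act_cls_le (ofModule F)).symm
  exact (ofModule_le_iff F).trans (le_modHom F).symm

/-- An isomorphism of complete lattices is an isomorphism in `Sup`. -/
def supLatIso {L M : SupLat.{u}} (e : L ≃o M) : L ≅ M where
  hom := (e : sSupHom L M)
  inv := (e.symm : sSupHom M L)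
  hom_inv_id := sSupHom.ext fun x => e.symm_apply_apply x
  inv_hom_id := sSupHom.ext fun x => e.apply_symm_apply x

/-- Every module is isomorphic to the module of its `Q`-category. -/
noncomputable def toModuleOfModuleIso : F ≅ toModule.obj (ofModule F) :=
  ObjectProperty.isoMk _ (NatIso.ofComponents
    (fun X => supLatIso (M := SupLat.of ((ofModule F).Fibre X.unop))
      (ofModuleFibreIso F X.unop).symm)
    (fun f => sSupHom.ext fun y => ofModuleFibreIso_symm_res F f.unop y))

end EssSurj

/-! ### Comparison of epimorphisms and of projective objects -/

theorem isSurjection_iff_epi {B C : Cocont Q} (g : C ⟶ B) :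
    IsSurjection g ↔ Epi (toModule.map g) := by
  constructor
  · refine fun h => ⟨fun {M} k l hkl => ?_⟩
    -- The test arrows land in an arbitrary module; moving their codomain to the module of a
    -- cocomplete category lets fullness lift them.
    let i := toModuleOfModuleIso M
    obtain ⟨K, hK⟩ := toModule.map_surjective (k ≫ i.hom)
    obtain ⟨L, hL⟩ := toModule.map_surjective (l ≫ i.hom)
    have hKL : LocallyIso (g ≫ K) (g ≫ L) := by
      rw [locallyIso_iff_toModule_map_eq, Functor.map_comp, Functor.map_comp, hK, hL,
        reassoc_of% hkl]
    rw [← cancel_mono i.hom, ← hK, ← hL]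
    exact (locallyIso_iff_toModule_map_eq K L).1 (h K L hKL)
  · intro h Z K L hKL
    rw [locallyIso_iff_toModule_map_eq] at hKL ⊢
    rwa [Functor.map_comp, Functor.map_comp, cancel_epi] at hKL

theorem isProjective_iff_projective_toModule (A : Cocont Q) :
    IsProjective A ↔ Projective (toModule.obj A) := by
  constructor
  · refine fun h => ⟨fun {N M} f e _ => ?_⟩
    let i := toModuleOfModuleIso M
    let j := toModuleOfModuleIso N
    obtain ⟨K, hK⟩ := toModule.map_surjective (f ≫ i.hom)
    -- Conjugating `e` by isomorphisms keeps it an epimorphism, so its lift `G` is a valid test for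
    -- the projectivity of `A`.
    obtain ⟨G, hG⟩ := toModule.map_surjective (j.inv ≫ e ≫ i.hom)
    have hsurj : IsSurjection G := by
      rw [isSurjection_iff_epi, hG]
      infer_instance
    obtain ⟨H, hH⟩ := h K G hsurj
    rw [locallyIso_iff_toModule_map_eq, Functor.map_comp, hK, hG] at hH
    refine ⟨toModule.map H ≫ j.inv, ?_⟩
    rw [← cancel_mono i.hom, ← hH]
    simp
  · intro h B C f g hg
    have := (isSurjection_iff_epi g).1 hg
    obtain ⟨k, hk⟩ := h.factors (toModule.map f) (toModule.map g)
    obtain ⟨H, rfl⟩ := toModule.map_surjective k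
    refine ⟨H, ?_⟩
    rw [locallyIso_iff_toModule_map_eq, Functor.map_comp, hk]

/-- Isomorphisms of arrows become equalities of module morphisms, so mutually quasi-inverse arrows
become mutually inverse. -/
theorem nonempty_toModule_iso_of_equivalent {A B : Cocont Q} (h : Equivalent A B) :
    Nonempty (toModule.obj A ≅ toModule.obj B) := by
  obtain ⟨f, g, hfg, hgf⟩ := h
  rw [locallyIso_iff_toModule_map_eq, Functor.map_comp, CategoryTheory.Functor.map_id] at hfg hgf
  exact ⟨⟨toModule.map f, toModule.map g, hfg, hgf⟩⟩

end QEnriched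

open QEnriched
/-- Let `Q` be a small quantaloid, and let the cocomplete `Q`-category `A` and the `Q`-module `F`
correspond to each other: `F` is isomorphic to the module of `A`, or `A` is equivalent to the
cocomplete `Q`-category of `F`. Then `A` is projective in `Cocont(Q)` if and only if `F` is
projective in `QUANT(Qᵒᵖ, Sup)`. -/
theorem propositiona0 {Q : Type*} [SmallCategory Q] [Quantaloid Q]
    (A : Cocont Q) (F : QUANT Qᵒᵖ SupLat)
    (h : Nonempty (toModule.obj A ≅ F) ∨ Equivalent A (ofModule F)) :
    IsProjective A ↔ Projective F := by
  -- The second form of the correspondence reduces to the first, since the module of `C_F` is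
  -- isomorphic to `F`.
  have hiso : Nonempty (toModule.obj A ≅ F) := by
    refine h.elim id fun h => ?_
    obtain ⟨i⟩ := nonempty_toModule_iso_of_equivalent h
    exact ⟨i ≪≫ (toModuleOfModuleIso F).symm⟩
  obtain ⟨i⟩ := hiso
  exact (isProjective_iff_projective_toModule A).trans (Projective.iso_iff i)
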